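/- Let $p$ be an odd prime, let $r\ge 2$ be an integer, and let $n=2^r p$. Define subsets $A,B\subseteq \mathbb{Z}_n=\mathbb{Z}/n\mathbb{Z}$ by $$A=\{1+i2^r : 0\le i\le \tfrac{p-1}{2}\}\cup\{1+j2^r+\tfrac n2 : 1\le j\le \tfrac{p-1}{2}\},$$ $$B=\{1-i2^r : 0\le i\le \tfrac{p-1}{2}\}\cup\{1-j2^r+\tfrac n2 : 1\le j\le \tfrac{p-1}{2}\}.$$ For $S\subseteq\mathbb{Z}_n$, let $\mathrm{Cay}(\mathbb{Z}_n,S)$ be the directed graph with vertex set $\mathbb{Z}_n$ and an arc from $u$ to $v$ if and only if $v=u+s$ for some $s\in S$. Then the directed graphs $X=\mathrm{Cay}(\mathbb{Z}_n,A)$ and $Y=\mathrm{Cay}(\mathbb{Z}_n,B)$ are isospectral, that is, their adjacency matrices have the same complex eigenvalues with the same multiplicities, and they are not isomorphic as directed graphs. -/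

import Mathlib

/-- The directed Cayley graph `Cay(ℤ_n, S)`: there is an arc from `u` to `v` exactly when
`v = u + s` for some `s ∈ S`. -/
def circulantDigraph (n : ℕ) (S : Set (ZMod n)) : Digraph (ZMod n) where
  Adj u v := ∃ s ∈ S, v = u + s

open Classical in
/-- The complex `0`-`1` adjacency matrix of a digraph. -/
noncomputable def Digraph.adjacencyMatrix {V : Type*} (X : Digraph V) : Matrix V V ℂ :=
  Matrix.of fun u v => if X.Adj u v then 1 else 0

/-- The spectrum of a finite digraph: the multiset of complex eigenvalues of its adjacency matrix,
listed with algebraic multiplicity. -/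
noncomputable def Digraph.eigenvalueMultiset {V : Type*} [Fintype V] [DecidableEq V]
    (X : Digraph V) : Multiset ℂ :=
  X.adjacencyMatrix.charpoly.roots

/-- Two finite digraphs are isospectral if their spectra agree, multiplicities included. -/
def Digraph.Isospectral {V W : Type*} [Fintype V] [DecidableEq V] [Fintype W] [DecidableEq W]
    (X : Digraph V) (Y : Digraph W) : Prop :=
  X.eigenvalueMultiset = Y.eigenvalueMultiset

/-- Two digraphs are isomorphic if some bijection of the vertices preserves and reflects arcs. -/
def Digraph.Isomorphic {V W : Type*} (X : Digraph V) (Y : Digraph W) : Prop :=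
  Nonempty (X.Adj ≃r Y.Adj)

/-- `{1 + i 2^r : 0 ≤ i ≤ (p-1)/2} ∪ {1 + j 2^r + n/2 : 1 ≤ j ≤ (p-1)/2}` in `ℤ_n`
(used for `n` even and `p` odd, where both divisions are exact). -/
def connectionSetA (n r p : ℕ) : Set (ZMod n) :=
  {a | ∃ i : ℕ, i ≤ (p - 1) / 2 ∧ a = 1 + (i : ZMod n) * 2 ^ r} ∪
  {a | ∃ j : ℕ, 1 ≤ j ∧ j ≤ (p - 1) / 2 ∧
    a = 1 + (j : ZMod n) * 2 ^ r + ((n / 2 : ℕ) : ZMod n)}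

/-- `{1 - i 2^r : 0 ≤ i ≤ (p-1)/2} ∪ {1 - j 2^r + n/2 : 1 ≤ j ≤ (p-1)/2}` in `ℤ_n`
(used for `n` even and `p` odd, where both divisions are exact). -/
def connectionSetB (n r p : ℕ) : Set (ZMod n) :=
  {b | ∃ i : ℕ, i ≤ (p - 1) / 2 ∧ b = 1 - (i : ZMod n) * 2 ^ r} ∪
  {b | ∃ j : ℕ, 1 ≤ j ∧ j ≤ (p - 1) / 2 ∧
    b = 1 - (j : ZMod n) * 2 ^ r + ((n / 2 : ℕ) : ZMod n)}

/-! Write c = 2^r, h = n/2, m = (p-1)/2. The connection sets have the form {1} ∪ {1 + jc, 1 + jc + h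
: 1 ≤ j ≤ m}, with c for A and -c for B. Spectrum: with χ the standard character and z = χ(kc), the
k-th eigenvalue for A is χ(k)(1 + (1 + χ(kh)) ∑ z^j); for B, z⁻¹ replaces z. They agree if χ(kh) =
-1 or z = 1. Otherwise 1 + ∑ z^j + ∑ z⁻¹^j = 0 makes them opposite, and the shift k ↦ k + h, which
fixes kh and kc and negates χ(k), matches them (`isospectral_progressionSet`). Non-isomorphism: S \
(S + d) is a singleton only for d = h, and then it is {1}. An isomorphism therefore commutes with
translation by h, hence by 1, so it is a translation and A = B; but 1 + c lies only in A. -/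

/-- The set of all `1 + j c + e h` with `0 ≤ j ≤ m`, where `e` has to be even if `j = 0`. -/
def progressionSet {n : ℕ} (c h : ZMod n) (m : ℕ) : Set (ZMod n) :=
  {x | ∃ j e : ℤ, 0 ≤ j ∧ j ≤ m ∧ (j = 0 → 2 ∣ e) ∧ x = 1 + j * c + e * h}

/-- The pair `c, h` behaves like independent elements of orders `p` and `2`. -/
def IndepOrders {n : ℕ} (p : ℕ) (c h : ZMod n) : Prop :=
  ∀ x e : ℤ, (x : ZMod n) * c + e * h = 0 ↔ (p : ℤ) ∣ x ∧ 2 ∣ e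

namespace IndepOrders

variable {n p : ℕ} {c h : ZMod n}

theorem neg_left (H : IndepOrders p c h) : IndepOrders p (-c) h := by
  intro x e
  have := H (-x) e
  rw [dvd_neg] at this
  rw [← this]
  push_cast
  rw [neg_mul, mul_neg]

theorem left_eq_zero (H : IndepOrders p c h) : (p : ZMod n) * c = 0 := by
  simpa using (H p 0).2 (by simp)

theorem even_mul (H : IndepOrders p c h) {e : ℤ} (he : 2 ∣ e) : (e : ZMod n) * h = 0 := by
  simpa using (H 0 e).2 (by simp [he])

theorem right_ne_zero (H : IndepOrders p c h) : h ≠ 0 := by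
  intro h0
  have := (H 0 1).1 (by simp [h0])
  omega

theorem right_add_right (H : IndepOrders p c h) : h + h = 0 := by
  have := H.even_mul (e := 2) (by simp)
  push_cast at this
  rw [← this]; ring

theorem odd_mul (H : IndepOrders p c h) {e : ℤ} (he : ¬ 2 ∣ e) : (e : ZMod n) * h = h := by
  have := H.even_mul (e := e - 1) (by omega)
  push_cast at this
  linear_combination this

theorem mem_imp (H : IndepOrders p c h) {m : ℕ} {x e : ℤ} {y : ZMod n}
    (hy : y ∈ progressionSet c h m) (hxy : y = 1 + x * c + e * h) :
    ∃ j : ℤ, 0 ≤ j ∧ j ≤ m ∧ (p : ℤ) ∣ x - j ∧ (j = 0 → 2 ∣ e) := by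
  obtain ⟨j, e', h0, h1, h2, h3⟩ := hy
  have := (H (x - j) (e - e')).1 (by push_cast; linear_combination h3 - hxy)
  exact ⟨j, h0, h1, this.1, fun hj => by have := h2 hj; omega⟩

theorem one_mem (c h : ZMod n) (m : ℕ) : (1 : ZMod n) ∈ progressionSet c h m :=
  ⟨0, 0, by simp⟩

theorem mem_and_sub_notMem_iff (H : IndepOrders p c h) {m : ℕ} (hp : p = 2 * m + 1)
    (x : ZMod n) :
    (x ∈ progressionSet c h m ∧ x - h ∉ progressionSet c h m) ↔ x = 1 := by
  constructor
  · rintro ⟨⟨j, e, h0, h1, h2, rfl⟩, hx⟩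
    by_cases hj : j = 0
    · rw [H.even_mul (h2 hj), hj]; simp
    · exact absurd ⟨j, e - 1, h0, h1, fun h => absurd h hj, by push_cast; ring⟩ hx
  · rintro rfl
    refine ⟨one_mem c h m, fun hm => ?_⟩
    obtain ⟨j, h0, h1, h2, h3⟩ := H.mem_imp (x := 0) (e := -1) hm (by push_cast; ring)
    have : j = 0 := by
      by_contra hj
      have := Int.le_of_dvd (by omega) ((dvd_neg.2 h2))
      omega
    have := h3 this
    omega

/-- Lets the arcs determine translation by h. For any other d, S \ (S + d) is empty or contains two
elements. -/
theorem eq_right_of_sub_singleton (H : IndepOrders p c h) {m : ℕ} (hp : p = 2 * m + 1)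
    (hm : 1 ≤ m) {d t : ZMod n}
    (hd : ∀ x, (x ∈ progressionSet c h m ∧ x - d ∉ progressionSet c h m) ↔ x = t) : d = h := by
  -- Otherwise 1 + c and 1 + c + h would both equal t.
  have key : ∃ e : ℤ, 1 + c + e * h - d ∈ progressionSet c h m := by
    by_contra! hcon
    have h0 := (hd (1 + c + (0 : ℤ) * h)).1
      ⟨⟨1, 0, by omega, by omega, by omega, by push_cast; ring⟩, hcon 0⟩
    have h1 := (hd (1 + c + (1 : ℤ) * h)).1
      ⟨⟨1, 1, by omega, by omega, by omega, by push_cast; ring⟩, hcon 1⟩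
    apply H.right_ne_zero
    push_cast at h0 h1
    linear_combination h1 - h0
  obtain ⟨e₁, j, e₂, hj0, hjm, -, he⟩ := key
  obtain ⟨e, hde⟩ : ∃ e : ℤ, d = ((1 - j : ℤ) : ZMod n) * c + e * h :=
    ⟨e₁ - e₂, by push_cast; linear_combination -he⟩
  obtain hj | hj | hj : j = 0 ∨ j = 1 ∨ 2 ≤ j := by omega
  -- Here d = c + eh, and both 1 and 1 + c + (1 + e)h survive: subtracting d gives a c-coefficient
  -- -1, beyond m modulo p, or the missing point 1 + h.
  · subst hj
    have h0 := (hd 1).1 ⟨one_mem c h m, fun hx => by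
      obtain ⟨i, hi0, hi1, hi2, -⟩ := H.mem_imp (x := -1) (e := -e) hx
        (by rw [hde]; push_cast; ring)
      have := Int.le_of_dvd (by omega) ((dvd_neg.2 hi2))
      omega⟩
    have h1 := (hd (1 + c + (1 + e : ℤ) * h)).1
      ⟨⟨1, 1 + e, by omega, by omega, by omega, by push_cast; ring⟩, fun hx => by
      obtain ⟨i, hi0, hi1, hi2, hi3⟩ := H.mem_imp (x := 0) (e := 1) hx
        (by rw [hde]; push_cast; ring)
      have : i = 0 := by
        by_contra hj
        have := Int.le_of_dvd (by omega) ((dvd_neg.2 hi2))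
        omega
      have := hi3 this
      omega⟩
    have := ((H 1 (1 + e)).1 (by push_cast at h0 h1 ⊢; linear_combination h1 - h0)).1
    have := Int.le_of_dvd (by omega) this
    omega
  · subst hj
    by_cases h2 : 2 ∣ e
    · have hd0 : d = 0 := by rw [hde, H.even_mul h2]; simp
      have := (hd t).2 rfl
      simp [hd0] at this
    · rw [hde, H.odd_mul h2]; simp
  -- The c-coefficient m + j - 1 of the shifted points lies strictly between m and p, so both points
  -- over 1 + mc survive.
  · have hall : ∀ i : ℤ, 1 + (m : ZMod n) * c + i * h = t := fun i =>
      (hd _).1 ⟨⟨m, i, by omega, by omega, by omega, by push_cast; ring⟩, fun hx => by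
        obtain ⟨l, hl0, hl1, hl2, -⟩ := H.mem_imp (x := m - (1 - j)) (e := i - e) hx
          (by rw [hde]; push_cast; ring)
        have := Int.le_of_dvd (by omega) hl2
        omega⟩
    refine absurd ?_ H.right_ne_zero
    have h0 := hall 0
    have h1 := hall 1
    push_cast at h0 h1
    linear_combination h1 - h0

theorem progressionSet_neg_ne (H : IndepOrders p c h) {m : ℕ} (hp : p = 2 * m + 1)
    (hm : 1 ≤ m) : progressionSet c h m ≠ progressionSet (-c) h m := by
  intro heq
  have h1 : 1 + c ∈ progressionSet c h m :=
    ⟨1, 0, by omega, by omega, by omega, by push_cast; ring⟩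
  rw [heq] at h1
  obtain ⟨j, h0, h1, h2, -⟩ := H.neg_left.mem_imp (x := -1) (e := 0) h1 (by push_cast; ring)
  have := Int.le_of_dvd (by omega) ((dvd_neg.2 h2))
  omega

/-- Sums over `progressionSet c h m`. -/
theorem sum_progressionSet [NeZero n] (H : IndepOrders p c h) {m : ℕ} (hp : p = 2 * m + 1)
    (g : ZMod n → ℂ) [DecidablePred (· ∈ progressionSet c h m)] :
    ∑ x, (if x ∈ progressionSet c h m then g x else 0) =
      g 1 + ∑ j ∈ Finset.Icc 1 m, (g (1 + j * c) + g (1 + j * c + h)) := by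
  classical
  let T : Finset (ℕ × ℕ) := insert (0, 0) (Finset.Icc 1 m ×ˢ Finset.range 2)
  let φ : ℕ × ℕ → ZMod n := fun q => 1 + q.1 * c + q.2 * h
  have hT : ∀ q ∈ T, q.1 ≤ m ∧ q.2 < 2 ∧ (q.1 = 0 → q.2 = 0) := by
    intro q hq
    simp only [T, Finset.mem_insert, Finset.mem_product, Finset.mem_Icc, Finset.mem_range] at hq
    rcases hq with rfl | hq
    · simp
    · omega
  have hinj : Set.InjOn φ T := by
    intro a ha b hb hab
    have ha := hT a ha
    have hb := hT b hb
    have := (H (a.1 - b.1) (a.2 - b.2)).1 (by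
      simp only [φ] at hab; push_cast; linear_combination hab)
    have h1 : (a.1 : ℤ) - b.1 = 0 := by
      refine Int.eq_zero_of_abs_lt_dvd this.1 ?_
      rw [abs_lt]; omega
    ext <;> omega
  have himg : Finset.univ.filter (· ∈ progressionSet c h m) = T.image φ := by
    ext x
    simp only [Finset.mem_filter, Finset.mem_univ, true_and, Finset.mem_image]
    constructor
    · rintro ⟨j, e, h0, h1, h2, rfl⟩
      lift j to ℕ using h0
      by_cases he : 2 ∣ e
      · refine ⟨(j, 0), ?_, by simp [φ, H.even_mul he]⟩
        simp [T]
        omega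
      · refine ⟨(j, 1), ?_, by simp [φ, H.odd_mul he]⟩
        simp only [T, Finset.mem_insert, Finset.mem_product, Finset.mem_Icc, Finset.mem_range,
          Prod.mk.injEq]
        omega
    · rintro ⟨q, hq, rfl⟩
      have := hT q hq
      exact ⟨q.1, q.2, by omega, by omega, by omega, by simp [φ]⟩
  rw [← Finset.sum_filter, himg, Finset.sum_image hinj, Finset.sum_insert (by simp),
    Finset.sum_product]
  simp [φ, Finset.sum_range_succ]

end IndepOrders

/-! ### Rigidity of isomorphisms. -/

theorem circulantDigraph_adj {n : ℕ} {S : Set (ZMod n)} {u v : ZMod n} :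
    (circulantDigraph n S).Adj u v ↔ v - u ∈ S := by
  constructor
  · rintro ⟨s, hs, rfl⟩
    simpa using hs
  · exact fun h => ⟨v - u, h, by ring⟩

/-- If translation by `h` can be recovered from the arcs and in both digraphs `u + 1` is the only
out-neighbour of `u` that is not one of `u + h`, then isomorphisms are translations. -/
theorem eq_of_isomorphic_circulantDigraph {n : ℕ} {S T : Set (ZMod n)} {h : ZMod n}
    (hS : ∀ x, (x ∈ S ∧ x - h ∉ S) ↔ x = 1) (hT : ∀ x, (x ∈ T ∧ x - h ∉ T) ↔ x = 1)
    (hd : ∀ d t, (∀ x, (x ∈ T ∧ x - d ∉ T) ↔ x = t) → d = h)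
    (hiso : (circulantDigraph n S).Isomorphic (circulantDigraph n T)) : S = T := by
  obtain ⟨f⟩ := hiso
  have hf : ∀ u v, f v - f u ∈ T ↔ v - u ∈ S := fun u v => by
    rw [← circulantDigraph_adj, ← circulantDigraph_adj]
    exact f.map_rel_iff
  have key : ∀ u x, (x ∈ T ∧ x - (f (u + h) - f u) ∉ T) ↔ x = f (u + 1) - f u := by
    intro u x
    obtain ⟨v, hv⟩ := f.surjective (f u + x)
    have hx : x = f v - f u := by rw [hv]; ring
    rw [hx, hf, sub_sub_sub_cancel_right, hf, ← sub_sub, hS, sub_left_inj, f.injective.eq_iff,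
      sub_eq_iff_eq_add']
  have hfh : ∀ u, f (u + h) - f u = h := fun u => hd _ _ (key u)
  have hf1 : ∀ u, f (u + 1) = f u + 1 := fun u => by
    have := (key u (f (u + 1) - f u)).2 rfl
    rw [hfh, hT] at this
    linear_combination this
  have htrans : ∀ k : ℤ, f k = f 0 + k := fun k => by
    induction k using Int.induction_on with
    | zero => simp
    | succ i ih => push_cast at ih ⊢; rw [hf1, ih]; ring
    | pred i ih =>
      have := hf1 ((-(i : ℤ) - 1 : ℤ) : ZMod n)
      push_cast at ih this ⊢
      rw [sub_add_cancel, ih] at this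
      linear_combination -this
  ext s
  obtain ⟨k, rfl⟩ := ZMod.intCast_surjective s
  have := hf 0 k
  rw [htrans, add_sub_cancel_left, sub_zero] at this
  exact this.symm

/-! ### Spectra through additive characters. -/

/-- The eigenvalue of `circulantDigraph n S` at the `k`-th additive character. -/
noncomputable def circulantEigenvalue (n : ℕ) [NeZero n] (S : Set (ZMod n)) (k : ZMod n) : ℂ :=
  open Classical in ∑ s, if s ∈ S then ZMod.stdAddChar (k * s) else 0

/-- The character matrix F diagonalizes the adjacency matrix; orthogonality of characters gives its
inverse G. -/
theorem charpoly_circulantDigraph (n : ℕ) [NeZero n] (S : Set (ZMod n)) :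
    (circulantDigraph n S).adjacencyMatrix.charpoly =
      ∏ k, (Polynomial.X - Polynomial.C (circulantEigenvalue n S k)) := by
  classical
  let F : Matrix (ZMod n) (ZMod n) ℂ := Matrix.of fun u k => ZMod.stdAddChar (k * u)
  let G : Matrix (ZMod n) (ZMod n) ℂ :=
    Matrix.of fun k u => (n : ℂ)⁻¹ * ZMod.stdAddChar (-(k * u))
  have hn : (n : ℂ) ≠ 0 := Nat.cast_ne_zero.2 (NeZero.ne n)
  have hFG : F * G = 1 := by
    ext u v
    have : ∑ k : ZMod n, ZMod.stdAddChar (N := n) (k * (u - v)) =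
        if u - v = 0 then (Fintype.card (ZMod n) : ℂ) else 0 :=
      mod_cast AddChar.sum_mulShift (u - v) (ZMod.isPrimitive_stdAddChar n)
    simp only [ZMod.card, sub_eq_zero] at this
    calc (F * G) u v = (n : ℂ)⁻¹ * ∑ k : ZMod n, ZMod.stdAddChar (N := n) (k * (u - v)) := by
          rw [Matrix.mul_apply, Finset.mul_sum]
          refine Finset.sum_congr rfl fun k _ => ?_
          simp only [F, G, Matrix.of_apply]
          rw [mul_sub, sub_eq_add_neg, AddChar.map_add_eq_mul]
          ring
      _ = _ := by rw [this, Matrix.one_apply]; split_ifs <;> simp [hn]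
  have hGF : G * F = 1 := mul_eq_one_comm.1 hFG
  have hMF : (circulantDigraph n S).adjacencyMatrix * F =
      F * Matrix.diagonal (circulantEigenvalue n S) := by
    ext u k
    rw [Matrix.mul_diagonal, Matrix.mul_apply, circulantEigenvalue, Finset.mul_sum,
      ← Equiv.sum_comp (Equiv.addLeft u)]
    refine Finset.sum_congr rfl fun s _ => ?_
    simp only [Digraph.adjacencyMatrix, Matrix.of_apply, F, circulantDigraph_adj,
      Equiv.coe_addLeft, add_sub_cancel_left]
    split_ifs
    · rw [one_mul, mul_add, AddChar.map_add_eq_mul]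
    · simp
  have hM : (circulantDigraph n S).adjacencyMatrix =
      F * Matrix.diagonal (circulantEigenvalue n S) * G := by
    rw [← hMF, mul_assoc, hFG, mul_one]
  rw [hM, mul_assoc, Matrix.charpoly_mul_comm, mul_assoc, hGF, mul_one, Matrix.charpoly_diagonal]

theorem circulantEigenvalue_progressionSet {n p m : ℕ} [NeZero n] {c h : ZMod n}
    (H : IndepOrders p c h) (hp : p = 2 * m + 1) (k : ZMod n) :
    circulantEigenvalue n (progressionSet c h m) k = ZMod.stdAddChar k *
      (1 + (1 + ZMod.stdAddChar (k * h)) *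
        ∑ j ∈ Finset.Icc 1 m, ZMod.stdAddChar (k * c) ^ j) := by
  classical
  rw [circulantEigenvalue, H.sum_progressionSet hp (fun s => ZMod.stdAddChar (k * s)), mul_one,
    mul_add, mul_one, Finset.mul_sum, Finset.mul_sum]
  congr 1
  refine Finset.sum_congr rfl fun j _ => ?_
  rw [← AddChar.map_nsmul_eq_pow, show k * (1 + j * c + h) = k + j • (k * c) + k * h by
    rw [nsmul_eq_mul]; ring, show k * (1 + j * c) = k + j • (k * c) by rw [nsmul_eq_mul]; ring]
  simp only [AddChar.map_add_eq_mul]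
  ring

/-- Since z⁻¹^j = z^(p-j), this is the full geometric sum over 0 ≤ j < p. -/
theorem one_add_sum_pow_add_sum_inv_pow {p m : ℕ} (hp : p = 2 * m + 1) {z : ℂ}
    (hz : z ^ p = 1) (hz1 : z ≠ 1) :
    1 + ∑ j ∈ Finset.Icc 1 m, z ^ j + ∑ j ∈ Finset.Icc 1 m, z⁻¹ ^ j = 0 := by
  have hz0 : z ≠ 0 := by
    rintro rfl
    simp [hp] at hz
  have hgeom : ∑ j ∈ Finset.range p, z ^ j = 0 := by
    have := mul_geom_sum z p
    rw [hz, sub_self] at this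
    exact (mul_eq_zero.1 this).resolve_left (sub_ne_zero.2 hz1)
  have h1 : ∑ j ∈ Finset.Icc 1 m, z⁻¹ ^ j = ∑ j ∈ Finset.Ico (m + 1) p, z ^ j := by
    refine Finset.sum_nbij' (fun j => p - j) (fun j => p - j) ?_ ?_ ?_ ?_ ?_
    · intro j hj; simp only [Finset.mem_Icc, Finset.mem_Ico] at *; omega
    · intro j hj; simp only [Finset.mem_Icc, Finset.mem_Ico] at *; omega
    · intro j hj; simp only [Finset.mem_Icc] at *; omega
    · intro j hj; simp only [Finset.mem_Ico] at *; omega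
    · intro j hj
      simp only [Finset.mem_Icc] at hj
      rw [inv_pow, inv_eq_iff_eq_inv, eq_comm, inv_eq_iff_eq_inv, eq_comm]
      rw [inv_eq_iff_eq_inv, ← one_div, eq_div_iff (pow_ne_zero _ hz0), ← pow_add,
        Nat.add_sub_cancel' (by omega), hz]
  have h2 : 1 + ∑ j ∈ Finset.Icc 1 m, z ^ j = ∑ j ∈ Finset.range (m + 1), z ^ j := by
    rw [Finset.sum_range_eq_add_Ico _ (Nat.succ_pos m), pow_zero]
    rfl
  rw [h1, h2, Finset.sum_range_add_sum_Ico _ (by omega), hgeom]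

open Classical in
theorem isospectral_progressionSet {n p m : ℕ} [NeZero n] {c h : ZMod n}
    (H : IndepOrders p c h) (hp : p = 2 * m + 1) (hhh : h * h = 0) (hhc : h * c = 0) :
    (circulantDigraph n (progressionSet c h m)).Isospectral
      (circulantDigraph n (progressionSet (-c) h m)) := by
  set χ := ZMod.stdAddChar (N := n)
  -- The indices where the two eigenvalues are opposite; P is invariant under k ↦ k + h, so σ is an
  -- involution.
  let P : ZMod n → Prop := fun k => χ (k * h) = 1 ∧ χ (k * c) ≠ 1
  have hP : ∀ k, P (k + h) ↔ P k := fun k => by simp [P, add_mul, hhh, hhc]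
  let σ : ZMod n → ZMod n := fun k => if P k then k + h else k
  have hσ : Function.Involutive σ := by
    intro k
    by_cases hk : P k
    · simp [σ, hk, hP, add_assoc, H.right_add_right]
    · simp [σ, hk]
  have hsq : ∀ x, χ (x * h) = 1 ∨ χ (x * h) = -1 := fun x => by
    rw [← sq_eq_one_iff, sq, ← AddChar.map_add_eq_mul, ← mul_add, H.right_add_right, mul_zero,
      AddChar.map_zero_eq_one]
  have hχh : χ h = -1 := by
    have := hsq 1
    rw [one_mul] at this
    refine this.resolve_left fun h1 => H.right_ne_zero ?_
    exact ZMod.injective_stdAddChar (h1.trans (AddChar.map_zero_eq_one χ).symm)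
  have hval : ∀ k, circulantEigenvalue n (progressionSet (-c) h m) k =
      circulantEigenvalue n (progressionSet c h m) (σ k) := by
    intro k
    rw [circulantEigenvalue_progressionSet H hp, circulantEigenvalue_progressionSet H.neg_left hp,
      mul_neg, AddChar.map_neg_eq_inv]
    by_cases hk : P k
    · have hz : χ (k * c) ^ p = 1 := by
        rw [← AddChar.map_nsmul_eq_pow, nsmul_eq_mul, mul_left_comm, H.left_eq_zero, mul_zero,
          AddChar.map_zero_eq_one]
      have := one_add_sum_pow_add_sum_inv_pow hp hz hk.2
      simp only [σ, hk, if_true, add_mul, hhh, hhc, add_zero, AddChar.map_add_eq_mul]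
      change χ k * (1 + (1 * _ + χ (k * h) * _)) =
        χ k * χ h * (1 + (1 * _ + χ (k * h) * _))
      rw [hk.1, hχh]
      linear_combination 2 * χ k * this
    · simp only [σ, hk, if_false]
      change χ k * (1 + (1 + χ (k * h)) * _) = χ k * (1 + (1 + χ (k * h)) * _)
      rcases hsq k with h1 | h1
      · have : χ (k * c) = 1 := by
          by_contra h2
          exact hk ⟨h1, h2⟩
        change _ * (1 + _ * ∑ j ∈ Finset.Icc 1 m, (χ (k * c))⁻¹ ^ j) =
          _ * (1 + _ * ∑ j ∈ Finset.Icc 1 m, χ (k * c) ^ j)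
        rw [this, inv_one]
      · rw [h1]; ring
  unfold Digraph.Isospectral Digraph.eigenvalueMultiset
  rw [charpoly_circulantDigraph, charpoly_circulantDigraph, ← Equiv.prod_comp (hσ.toPerm σ)]
  simp only [hval]
  rfl

/-! ### The case c = 2^r, h = n/2. -/

theorem indepOrders_two_pow {n r p : ℕ} (hodd : Odd p) (hr : 2 ≤ r) (hn : n = 2 ^ r * p) :
    IndepOrders (n := n) p (2 ^ r) ((n / 2 : ℕ) : ZMod n) := by
  intro x e
  obtain ⟨q, rfl⟩ : ∃ q, r = q + 1 := ⟨r - 1, by omega⟩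
  have hhalf : n / 2 = 2 ^ q * p := by
    rw [hn, pow_succ, show 2 ^ q * 2 * p = 2 ^ q * p * 2 by ring, Nat.mul_div_cancel _ two_pos]
  have hcast : (x : ZMod n) * 2 ^ (q + 1) + e * ((n / 2 : ℕ) : ZMod n) =
      ((2 ^ q * (2 * x + e * p) : ℤ) : ZMod n) := by
    rw [hhalf]; push_cast; ring
  have hnz : (n : ℤ) = 2 ^ q * (2 * p) := by rw [hn]; push_cast; ring
  rw [hcast, ZMod.intCast_zmod_eq_zero_iff_dvd, hnz,
    mul_dvd_mul_iff_left (pow_ne_zero q two_ne_zero)]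
  obtain ⟨m, hm⟩ := hodd
  have hcop : IsCoprime (2 : ℤ) p := ⟨-m, 1, by rw [hm]; push_cast; ring⟩
  constructor
  · intro hdvd
    refine ⟨?_, ?_⟩
    · refine hcop.symm.dvd_of_dvd_mul_left ?_
      exact (dvd_add_left (dvd_mul_left _ _)).1 ((dvd_mul_left _ _).trans hdvd)
    · refine hcop.dvd_of_dvd_mul_right ?_
      exact (dvd_add_right (dvd_mul_right _ _)).1 ((dvd_mul_right _ _).trans hdvd)
  · rintro ⟨h1, h2⟩
    exact dvd_add (mul_dvd_mul_left 2 h1) (mul_dvd_mul h2 dvd_rfl)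

theorem eq_progressionSet {n p m : ℕ} {c h : ZMod n} (H : IndepOrders p c h) :
    {a | ∃ i : ℕ, i ≤ m ∧ a = 1 + (i : ZMod n) * c} ∪
      {a | ∃ j : ℕ, 1 ≤ j ∧ j ≤ m ∧ a = 1 + (j : ZMod n) * c + h} = progressionSet c h m := by
  ext x
  constructor
  · rintro (⟨i, hi, rfl⟩ | ⟨j, hj1, hj, rfl⟩)
    · exact ⟨i, 0, by omega, by omega, by omega, by simp⟩
    · exact ⟨j, 1, by omega, by omega, by omega, by simp⟩
  · rintro ⟨j, e, h0, h1, h2, rfl⟩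
    lift j to ℕ using h0
    by_cases he : 2 ∣ e
    · exact Or.inl ⟨j, by omega, by simp [H.even_mul he]⟩
    · exact Or.inr ⟨j, by omega, by omega, by simp [H.odd_mul he]⟩

theorem mainTheorem3 (n r p : ℕ) [NeZero n] (hp : p.Prime) (hodd : Odd p) (hr : 2 ≤ r)
    (hn : n = 2 ^ r * p) :
    (circulantDigraph n (connectionSetA n r p)).Isospectral
        (circulantDigraph n (connectionSetB n r p)) ∧
      ¬ (circulantDigraph n (connectionSetA n r p)).Isomorphic
        (circulantDigraph n (connectionSetB n r p)) := by
  have H := indepOrders_two_pow hodd hr hn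
  have hA := eq_progressionSet (m := (p - 1) / 2) H
  have hB := eq_progressionSet (m := (p - 1) / 2) H.neg_left
  simp only [mul_neg, ← sub_eq_add_neg] at hB
  have hpm : p = 2 * ((p - 1) / 2) + 1 := by
    obtain ⟨m, rfl⟩ := hodd
    omega
  have hm : 1 ≤ (p - 1) / 2 := by
    have := hp.two_le
    omega
  -- Here r ≥ 2 is needed: n/2 is even, so h * h = 0.
  obtain ⟨q, hq⟩ : ∃ q, n / 2 = 2 * q ∧ n / 2 * 2 = n := by
    obtain ⟨s, rfl⟩ : ∃ s, r = s + 2 := ⟨r - 2, by omega⟩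
    have : n = 4 * (2 ^ s * p) := by rw [hn]; ring
    exact ⟨2 ^ s * p, by omega, by omega⟩
  have hh2 : ((n / 2 : ℕ) : ZMod n) * 2 = 0 := by
    have := congrArg (Nat.cast (R := ZMod n)) hq.2
    simpa using this
  rw [connectionSetA, connectionSetB, hA, hB]
  refine ⟨isospectral_progressionSet H hpm ?_ ?_, fun hiso => ?_⟩
  · have := congrArg (Nat.cast (R := ZMod n)) hq.1
    push_cast at this
    nth_rewrite 2 [this]
    rw [← mul_assoc, hh2, zero_mul]
  · obtain ⟨s, rfl⟩ : ∃ s, r = s + 1 := ⟨r - 1, by omega⟩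
    rw [pow_succ', ← mul_assoc, hh2, zero_mul]
  · exact H.progressionSet_neg_ne hpm hm (eq_of_isomorphic_circulantDigraph
      (H.mem_and_sub_notMem_iff hpm) (H.neg_left.mem_and_sub_notMem_iff hpm)
      (fun _ _ => H.neg_left.eq_right_of_sub_singleton hpm hm) hiso)
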